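/- Let $H$ be a complex Hilbert space. For operators $S,B$ in a Hilbert space, $B$ is called $S$-bounded with constants $a,b\ge 0$ if $\mathcal D(S)\subseteq\mathcal D(B)$ and $\|Bx\|^2\le a^2\|x\|^2+b^2\|Sx\|^2$ for all $x\in\mathcal D(S)$; the $S$-bound of $B$ is the infimum of all $b\ge 0$ that occur in such an inequality with some $a\ge 0$. For a closed operator $S$, the resolvent set $\rho(S)$ consists of all $\lambda\in\mathbb C$ such that $S-\lambda:\mathcal D(S)\to H$ is bijective, $\sigma(S)=\mathbb C\setminus\rho(S)$, and $\sigma_{\mathrm{ess}}(S)$ is the set of all $\lambda\in\mathbb C$ such that $S-\lambda$ is not Fredholm, i.e. does not have both a finite-dimensional kernel and a range of finite codimension. Let $T$ be a (closed, densely defined, in general unbounded) normal operator on $H$, and let $A$ be a linear operator on $H$ that is $T$-bounded with constants $a,b\ge 0$ and whose $T$-bound is less than $1$. Let $\widetilde H\subseteq\mathcal D(T)$ be a finite-dimensional subspace, so that $\mathcal D(T)=\widetilde H\oplus\mathcal D_2$ with $\mathcal D_2=\mathcal D(T)\cap\widetilde H^\perp$, and assume that $T\widetilde H\subseteq\widetilde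 H$ and $T\mathcal D_2\subseteq\widetilde H^\perp$. Let $T_2$ be the restriction of $T$ to $\mathcal D_2$, viewed as an operator on $\widetilde H^\perp$, let $P_2$ be the orthogonal projection onto $\widetilde H^\perp$, and let $A_{22}=P_2A|_{\mathcal D_2}$, viewed as an operator on $\widetilde H^\perp$. Then $T+A$ and $T_2+A_{22}$ are closed, $A_{22}$ is $T_2$-bounded with the same constants $a,b$, and $$\sigma_{\mathrm{ess}}(T+A)=\sigma_{\mathrm{ess}}(T_2+A_{22}).$$ Moreover, if $U\subseteq\mathbb C\setminus\sigma_{\mathrm{ess}}(T+A)$ is open and connected and $U\cap\rho(T+A)\ne\emptyset$, then $\sigma(T+A)\cap U$ is at most countable, consists of eigenvalues of $T+A$, and has all its accumulation points in $\mathbb C$ on the boundary of $U$. -/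

import Mathlib

/-! Unbounded operators on a complex Hilbert space `H` are partially defined linear maps
`H →ₗ.[ℂ] H`; the sum `S + T` has domain `S.domain ⊓ T.domain`. -/

namespace UnboundedOp

noncomputable section

variable {H : Type*} [NormedAddCommGroup H] [InnerProductSpace ℂ H]

/-- The domain `{x ∈ D(R) : R x ∈ D(S)}` of the product `S R`. -/
def prodDomain (S R : H →ₗ.[ℂ] H) : Submodule ℂ H :=
  (S.domain.comap R.toFun).map R.domain.subtype

theorem prodDomain_mapsTo (S R : H →ₗ.[ℂ] H) (x : (R.domRestrict (prodDomain S R)).domain) :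
    R.domRestrict (prodDomain S R) x ∈ S.domain := by
  obtain ⟨x, ⟨y, hy, rfl⟩, hx⟩ := x
  exact hy

/-- The product `S R` of unbounded operators, `x ↦ S (R x)` on its maximal domain. -/
def prod (S R : H →ₗ.[ℂ] H) : H →ₗ.[ℂ] H :=
  S.comp (R.domRestrict (prodDomain S R)) (prodDomain_mapsTo S R)

/-- A normal operator: closed, densely defined, with `T T* = T* T` (including the domains). -/
structure IsNormal [CompleteSpace H] (T : H →ₗ.[ℂ] H) : Prop where
  isClosed : T.IsClosed
  dense_domain : Dense (T.domain : Set H)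
  comm : prod T T.adjoint = prod T.adjoint T

/-- `A` is `T`-bounded with constants `a, b ≥ 0`: `D(T) ⊆ D(A)` and
`‖A x‖² ≤ a² ‖x‖² + b² ‖T x‖²` for all `x ∈ D(T)`. -/
def IsRelBoundedWith (T A : H →ₗ.[ℂ] H) (a b : ℝ) : Prop :=
  0 ≤ a ∧ 0 ≤ b ∧ ∃ h : T.domain ≤ A.domain, ∀ x : T.domain,
    ‖A ⟨x, h x.2⟩‖ ^ 2 ≤ a ^ 2 * ‖(x : H)‖ ^ 2 + b ^ 2 * ‖T x‖ ^ 2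

/-- The `T`-bound of `A`: the infimum of all admissible `b`. It is meaningful if `A` is
`T`-bounded, that is, if the set is nonempty. -/
def relBound (T A : H →ₗ.[ℂ] H) : ℝ :=
  sInf {b : ℝ | ∃ a : ℝ, IsRelBoundedWith T A a b}

/-- The operator `S - z` with domain `D(S)`. -/
def subScalar (S : H →ₗ.[ℂ] H) (z : ℂ) : H →ₗ.[ℂ] H where
  domain := S.domain
  toFun := S.toFun - z • S.domain.subtype

/-- A Fredholm operator: a closed operator whose kernel has finite dimension and whose range has
finite codimension. (On a Hilbert space such an operator automatically has closed range.) -/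
def IsFredholm (S : H →ₗ.[ℂ] H) : Prop :=
  S.IsClosed ∧ FiniteDimensional ℂ (LinearMap.ker S.toFun) ∧
    FiniteDimensional ℂ (H ⧸ LinearMap.range S.toFun)

/-- The essential spectrum: all `z` such that `S - z` is not Fredholm. -/
def essSpectrum (S : H →ₗ.[ℂ] H) : Set ℂ :=
  {z | ¬ IsFredholm (subScalar S z)}

/-- The resolvent set of a closed operator `S`: all `z` such that `S - z : D(S) → H` is
bijective. -/
def resolventSet (S : H →ₗ.[ℂ] H) : Set ℂ :=
  {z | Function.Bijective (subScalar S z).toFun}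

/-- The spectrum. -/
def spectrum (S : H →ₗ.[ℂ] H) : Set ℂ :=
  (resolventSet S)ᶜ

/-- The set of eigenvalues. -/
def eigenvalues (S : H →ₗ.[ℂ] H) : Set ℂ :=
  {z | ∃ x : S.domain, x ≠ 0 ∧ S x = z • (x : H)}

/-- The part of `T` in a subspace `K` such that `T` maps `D(T) ∩ K` into `K`: the restriction of
`T` to `D(T) ∩ K`, viewed as an operator on `K`. -/
def part (T : H →ₗ.[ℂ] H) (K : Submodule ℂ H) (h : ∀ x : T.domain, (x : H) ∈ K → T x ∈ K) :
    K →ₗ.[ℂ] K where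
  domain := T.domain.comap K.subtype
  toFun :=
    { toFun := fun x => ⟨T ⟨((x : K) : H), x.2⟩, h ⟨((x : K) : H), x.2⟩ (x : K).2⟩
      map_add' := fun x y => Subtype.ext
        (T.map_add ⟨((x : K) : H), x.2⟩ ⟨((y : K) : H), y.2⟩)
      map_smul' := fun c x => Subtype.ext (T.map_smul c ⟨((x : K) : H), x.2⟩) }

/-- The compression of `A` to a subspace `K`: the operator `P A` restricted to `D(A) ∩ K`, viewed
as an operator on `K`, where `P` is the orthogonal projection onto `K`. -/
def compression (A : H →ₗ.[ℂ] H) (K : Submodule ℂ H) [K.HasOrthogonalProjection] :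
    K →ₗ.[ℂ] K where
  domain := A.domain.comap K.subtype
  toFun :=
    { toFun := fun x => K.orthogonalProjectionOnto (A ⟨((x : K) : H), x.2⟩)
      map_add' := fun x y => by
        rw [← map_add, ← A.map_add]
        rfl
      map_smul' := fun c x => by
        rw [RingHom.id_apply, ← map_smul, ← A.map_smul]
        rfl }

end

end UnboundedOp

/-! Two mechanisms carry the theorem. With `i` the inclusion of `D₂` into `D(T)` and `P` the
projection onto `Kᗮ`, invariance under `T` gives `T₂ + A₂₂ - z = P (T + A - z) i`. Here `i` is
injective with finite-dimensional cokernel and `P` is surjective with finite-dimensional kernel, so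
neither affects finiteness of kernel and cokernel. Both sums are closed because a relative bound
below one lets the perturbation be absorbed; equality of the essential spectra is then pure linear
algebra.

For the discreteness claims, a closed `S` is viewed on its graph, a Banach space, where `S - w` is a
bounded family analytic in `w`. Near a Fredholm point, bordering reduces bijectivity to the
nonvanishing of an analytic determinant, whose zeros are isolated unless it vanishes identically.
Connectedness of `U` excludes the latter throughout `U`
(`eventually_mem_resolventSet_of_isConnected`). -/

/-- A submodule has finite codimension iff it is complemented up to a finitely generated
submodule. -/
theorem Submodule.cofg_iff_exists_fg_sup_eq_top {k V : Type*} [Field k] [AddCommGroup V]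
    [Module k V] {N : Submodule k V} : N.CoFG ↔ ∃ F : Submodule k V, F.FG ∧ N ⊔ F = ⊤ := by
  constructor
  · intro h
    obtain ⟨F, hF⟩ := N.exists_isCompl
    exact ⟨F, h.fg_of_isCompl hF, hF.sup_eq_top⟩
  · rintro ⟨F, hF, h⟩
    exact hF.cofg_of_codisjoint (codisjoint_iff.mpr (by rw [sup_comm, h]))

/-! ### Fredholm maps in linear algebra. -/

namespace LinearMap

variable {k V W Z : Type*} [Field k] [AddCommGroup V] [Module k V] [AddCommGroup W] [Module k W]
  [AddCommGroup Z] [Module k Z]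

/-- A linear map with finite-dimensional kernel and cokernel. -/
def IsAlgFredholm (f : V →ₗ[k] W) : Prop :=
  (ker f).FG ∧ (range f).CoFG

theorem isAlgFredholm_comp_iff_of_surjective {f : V →ₗ[k] W} {g : W →ₗ[k] Z}
    (hg : Function.Surjective g) (hker : (ker g).FG) :
    IsAlgFredholm (g ∘ₗ f) ↔ IsAlgFredholm f := by
  have hrange : range (g ∘ₗ f) = (range f).map g := range_comp f g
  have hgtop : (⊤ : Submodule k W).map g = ⊤ := by rwa [Submodule.map_top, range_eq_top]
  unfold IsAlgFredholm
  refine and_congr ⟨fun h => ?_, fun h => ?_⟩ ?_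
  · exact h.of_le (ker_le_ker_comp f g)
  · refine Submodule.fg_of_fg_map_of_fg_inf_ker f (hker.of_le ?_) (h.of_le inf_le_right)
    rintro _ ⟨x, hx, rfl⟩
    exact hx
  · rw [Submodule.cofg_iff_exists_fg_sup_eq_top, Submodule.cofg_iff_exists_fg_sup_eq_top, hrange]
    constructor
    · rintro ⟨F, hF, h⟩
      obtain ⟨F', hF', rfl⟩ : ∃ F' : Submodule k W, F'.FG ∧ F'.map g = F := by
        obtain ⟨s, hs⟩ := g.exists_rightInverse_of_surjective (range_eq_top.mpr hg)
        exact ⟨F.map s, hF.map s, by rw [← Submodule.map_comp, hs, Submodule.map_id]⟩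
      refine ⟨F' ⊔ ker g, hF'.sup hker, ?_⟩
      rw [← Submodule.map_sup] at h
      rw [← sup_assoc, ← Submodule.comap_map_eq, h, Submodule.comap_top]
    · rintro ⟨F, hF, h⟩
      exact ⟨F.map g, hF.map g, by rw [← Submodule.map_sup, h, hgtop]⟩

/-- The kernel of `f ∘ₗ i` is a copy of `ker f ⊓ range i`, and `ker f` modulo this embeds in the
finite-dimensional cokernel of `i`. Likewise, the range of `f` exceeds that of `f ∘ₗ i` only by the
image of a finite-dimensional complement. -/
theorem isAlgFredholm_comp_iff_of_injective {i : V →ₗ[k] W} {f : W →ₗ[k] Z}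
    (hi : Function.Injective i) (hcoker : (range i).CoFG) :
    IsAlgFredholm (f ∘ₗ i) ↔ IsAlgFredholm f := by
  have hmap : (ker (f ∘ₗ i)).map i = ker f ⊓ range i := by
    rw [ker_comp, Submodule.map_comap_eq, inf_comm]
  unfold IsAlgFredholm
  refine and_congr ⟨fun h => ?_, fun h => ?_⟩ ?_
  · refine Submodule.fg_of_fg_map_of_fg_inf_ker (range i).mkQ (IsNoetherian.noetherian _) ?_
    rw [Submodule.ker_mkQ, ← hmap]
    exact h.map i
  · refine Submodule.fg_of_fg_map_of_fg_inf_ker i ?_ ?_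
    · rw [hmap]
      exact h.of_le inf_le_left
    · rw [ker_eq_bot.mpr hi, inf_bot_eq]
      exact Submodule.fg_bot
  · refine ⟨fun h => h.of_le (range_comp_le_range i f), fun h => ?_⟩
    obtain ⟨F, hF, hF'⟩ := Submodule.cofg_iff_exists_fg_sup_eq_top.mp h
    obtain ⟨G, hG, hG'⟩ := Submodule.cofg_iff_exists_fg_sup_eq_top.mp hcoker
    refine Submodule.cofg_iff_exists_fg_sup_eq_top.mpr ⟨G.map f ⊔ F, (hG.map f).sup hF, ?_⟩
    rw [← sup_assoc, range_comp, ← Submodule.map_sup, hG', Submodule.map_top, hF']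

end LinearMap

/-! ### Closedness, relative bounds and compressions. -/

namespace UnboundedOp

variable {H : Type*} [NormedAddCommGroup H] [InnerProductSpace ℂ H]

theorem isFredholm_iff {S : H →ₗ.[ℂ] H} :
    IsFredholm S ↔ S.IsClosed ∧ S.toFun.IsAlgFredholm := by
  unfold IsFredholm LinearMap.IsAlgFredholm
  rw [FiniteDimensional, Module.Finite.iff_fg]

theorem mem_graph_subScalar {S : H →ₗ.[ℂ] H} {z : ℂ} {p : H × H} :
    p ∈ (subScalar S z).graph ↔ (p.1, p.2 + z • p.1) ∈ S.graph := by
  rw [LinearPMap.mem_graph_iff, LinearPMap.mem_graph_iff]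
  constructor
  · rintro ⟨x, hx, h⟩
    refine ⟨x, hx, ?_⟩
    change S x = p.2 + z • p.1
    rw [← h, ← hx]
    exact (sub_add_cancel _ _).symm
  · rintro ⟨x, hx, h⟩
    refine ⟨x, hx, ?_⟩
    change S x - z • (x : H) = p.2
    rw [h, hx]
    exact add_sub_cancel_right _ _

theorem isClosed_subScalar {S : H →ₗ.[ℂ] H} (hS : S.IsClosed) (z : ℂ) :
    (subScalar S z).IsClosed := by
  have h : ((subScalar S z).graph : Set (H × H)) =
      (fun p : H × H => (p.1, p.2 + z • p.1)) ⁻¹' S.graph :=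
    Set.ext fun p => mem_graph_subScalar
  unfold LinearPMap.IsClosed
  rw [h]
  exact hS.preimage (by fun_prop)

theorem mem_essSpectrum_iff {S : H →ₗ.[ℂ] H} (hS : S.IsClosed) {z : ℂ} :
    z ∈ essSpectrum S ↔ ¬ (subScalar S z).toFun.IsAlgFredholm := by
  change ¬ IsFredholm _ ↔ _
  rw [isFredholm_iff]
  simp [isClosed_subScalar hS z]

theorem IsRelBoundedWith.norm_le {T A : H →ₗ.[ℂ] H} {a b : ℝ} (h : IsRelBoundedWith T A a b)
    (hdom : T.domain ≤ A.domain) (x : T.domain) :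
    ‖A ⟨x, hdom x.2⟩‖ ≤ a * ‖(x : H)‖ + b * ‖T x‖ := by
  obtain ⟨ha, hb, _, hx⟩ := h
  refine le_of_sq_le_sq ?_ (by positivity)
  have h1 := hx x
  have h2 : 0 ≤ (a * ‖(x : H)‖) * (b * ‖T x‖) := by positivity
  nlinarith

theorem exists_isRelBoundedWith_lt_one {T A : H →ₗ.[ℂ] H} {a b : ℝ}
    (hA : IsRelBoundedWith T A a b) (hδ : relBound T A < 1) :
    ∃ a' b', b' < 1 ∧ IsRelBoundedWith T A a' b' := by
  obtain ⟨b', ⟨a', h⟩, hb'⟩ := exists_lt_of_csInf_lt (s := {b : ℝ | ∃ a : ℝ, IsRelBoundedWith T A a b})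
    ⟨b, a, hA⟩ hδ
  exact ⟨a', b', hb', h⟩

/-- Stability of closedness under relatively bounded perturbations with bound less than one. -/
theorem isClosed_add [CompleteSpace H] {T A : H →ₗ.[ℂ] H} {a b : ℝ} (hT : T.IsClosed)
    (hA : IsRelBoundedWith T A a b) (hb : b < 1) : (T + A).IsClosed := by
  have hdom := hA.2.2.1
  refine IsSeqClosed.isClosed fun p q hp hq => ?_
  simp only [SetLike.mem_coe, LinearPMap.mem_graph_iff] at hp
  choose x hx1 hx2 using hp
  let u : ℕ → T.domain := fun n => ⟨x n, (x n).2.1⟩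
  have hu : ∀ n, (u n : H) = (p n).1 := hx1
  have hsum : ∀ n, T (u n) + A ⟨u n, hdom (u n).2⟩ = (p n).2 := fun n => hx2 n
  have hq1 : Filter.Tendsto (fun n => (p n).1) Filter.atTop (nhds q.1) :=
    (continuous_fst.tendsto q).comp hq
  have hq2 : Filter.Tendsto (fun n => (p n).2) Filter.atTop (nhds q.2) :=
    (continuous_snd.tendsto q).comp hq
  -- The term `b * ‖T (u n) - T (u m)‖` from the relative bound moves to the left, leaving the
  -- factor `1 - b > 0`.
  have key : ∀ n m, ‖T (u n) - T (u m)‖ ≤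
      (‖(p n).2 - (p m).2‖ + a * ‖(p n).1 - (p m).1‖) / (1 - b) := by
    intro n m
    rw [le_div_iff₀ (by linarith)]
    have h1 := hA.norm_le hdom (u n - u m)
    have h2 : A ⟨((u n - u m : T.domain) : H), hdom (u n - u m).2⟩ =
        A ⟨u n, hdom (u n).2⟩ - A ⟨u m, hdom (u m).2⟩ := by
      rw [← LinearPMap.map_sub]; rfl
    rw [h2, LinearPMap.map_sub, Submodule.coe_sub] at h1
    simp only [← hu]
    have h3 : T (u n) - T (u m) = ((p n).2 - (p m).2) -
        (A ⟨u n, hdom (u n).2⟩ - A ⟨u m, hdom (u m).2⟩) := by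
      rw [← hsum, ← hsum]; abel
    have h4 := norm_sub_le ((p n).2 - (p m).2) (A ⟨u n, hdom (u n).2⟩ - A ⟨u m, hdom (u m).2⟩)
    rw [← h3] at h4
    linarith
  have hcau : CauchySeq fun n => T (u n) := by
    have hc1 := hq1.cauchySeq
    have hc2 := hq2.cauchySeq
    rw [cauchySeq_iff_tendsto_dist_atTop_0] at hc1 hc2 ⊢
    refine squeeze_zero (fun _ => dist_nonneg) (fun n => ?_)
      (g := fun n : ℕ × ℕ => (dist (p n.1).2 (p n.2).2 + a * dist (p n.1).1 (p n.2).1) / (1 - b)) ?_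
    · simp only [dist_eq_norm]; exact key _ _
    · simpa using (hc2.add (hc1.const_mul a)).div_const (1 - b)
  obtain ⟨t, ht⟩ := cauchySeq_tendsto_of_complete hcau
  have hgr : (q.1, t) ∈ T.graph := by
    refine hT.mem_of_tendsto (hq1.prodMk_nhds ht) (Filter.Eventually.of_forall fun n => ?_)
    exact (LinearPMap.mem_graph_iff _).mpr ⟨u n, hu n, rfl⟩
  obtain ⟨v, hv, hvt⟩ := (LinearPMap.mem_graph_iff _).mp hgr
  have hAlim : Filter.Tendsto (fun n => A ⟨u n, hdom (u n).2⟩) Filter.atTop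
      (nhds (A ⟨v, hdom v.2⟩)) := by
    rw [tendsto_iff_norm_sub_tendsto_zero]
    refine squeeze_zero (fun _ => norm_nonneg _) (fun n => ?_)
      (g := fun n => a * ‖(p n).1 - q.1‖ + b * ‖T (u n) - t‖) ?_
    · have h1 := hA.norm_le hdom (u n - v)
      have h2 : A ⟨((u n - v : T.domain) : H), hdom (u n - v).2⟩ =
          A ⟨u n, hdom (u n).2⟩ - A ⟨v, hdom v.2⟩ := by
        rw [← LinearPMap.map_sub]; rfl
      rw [h2, LinearPMap.map_sub, Submodule.coe_sub, hvt] at h1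
      simp only at hv
      rwa [← hu, ← hv]
    · simpa using ((tendsto_iff_norm_sub_tendsto_zero.mp hq1).const_mul a).add
        ((tendsto_iff_norm_sub_tendsto_zero.mp ht).const_mul b)
  have hlim : t + A ⟨v, hdom v.2⟩ = q.2 :=
    tendsto_nhds_unique (ht.add hAlim) (by simpa only [hsum] using hq2)
  refine (LinearPMap.mem_graph_iff _).mpr ⟨⟨v, v.2, hdom v.2⟩, hv, ?_⟩
  change T v + A ⟨v, hdom v.2⟩ = q.2
  rw [hvt, hlim]

theorem isClosed_part {T : H →ₗ.[ℂ] H} (hT : T.IsClosed) (K : Submodule ℂ H)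
    (h : ∀ x : T.domain, (x : H) ∈ K → T x ∈ K) : (part T K h).IsClosed := by
  have hgr : ((part T K h).graph : Set (K × K)) =
      (fun p : K × K => ((p.1 : H), (p.2 : H))) ⁻¹' T.graph := by
    ext p
    simp only [SetLike.mem_coe, Set.mem_preimage, LinearPMap.mem_graph_iff]
    constructor
    · rintro ⟨x, hx, hy⟩
      exact ⟨⟨((x : K) : H), x.2⟩, congrArg Subtype.val hx, congrArg Subtype.val hy⟩
    · rintro ⟨x, hx, hy⟩
      exact ⟨⟨p.1, show (p.1 : H) ∈ T.domain from hx ▸ x.2⟩, rfl, Subtype.ext ((congrArg T (Subtype.ext hx.symm)).trans hy)⟩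
  unfold LinearPMap.IsClosed
  rw [hgr]
  exact hT.preimage (by fun_prop)

/-- The orthogonal projection is a contraction and passing to the part preserves the norms of `x`
and `T x`, so the constants survive. -/
theorem IsRelBoundedWith.part_compression {T A : H →ₗ.[ℂ] H} {a b : ℝ}
    (hA : IsRelBoundedWith T A a b) (K : Submodule ℂ H) [K.HasOrthogonalProjection]
    (h : ∀ x : T.domain, (x : H) ∈ K → T x ∈ K) :
    IsRelBoundedWith (part T K h) (compression (A.domRestrict T.domain) K) a b := by
  obtain ⟨ha, hb, hdom, hx⟩ := hA
  refine ⟨ha, hb, fun x hx => ⟨hx, hdom hx⟩, fun x => ?_⟩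
  refine le_trans ?_ (hx ⟨((x : K) : H), x.2⟩)
  refine pow_le_pow_left₀ (norm_nonneg _) ?_ 2
  exact K.norm_orthogonalProjectionOnto_apply_le _

/-- Passing to the compression to the orthogonal complement of a finite-dimensional subspace of the
domain does not affect the Fredholm property. -/
theorem isAlgFredholm_subScalar_iff {T A : H →ₗ.[ℂ] H} (hdom : T.domain ≤ A.domain)
    (K : Submodule ℂ H) [FiniteDimensional ℂ K] (hK : K ≤ T.domain)
    (hK₂ : ∀ x : T.domain, (x : H) ∈ Kᗮ → T x ∈ Kᗮ) (z : ℂ) :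
    (subScalar (part T Kᗮ hK₂ + compression (A.domRestrict T.domain) Kᗮ) z).toFun.IsAlgFredholm ↔
      (subScalar (T + A) z).toFun.IsAlgFredholm := by
  let D := (subScalar (T + A) z).domain
  let D₂ := (subScalar (part T Kᗮ hK₂ + compression (A.domRestrict T.domain) Kᗮ) z).domain
  let i : D₂ →ₗ[ℂ] D :=
    LinearMap.codRestrict D (Kᗮ.subtype ∘ₗ D₂.subtype) fun x => ⟨x.2.1, hdom x.2.1⟩
  let P : H →ₗ[ℂ] Kᗮ := Kᗮ.orthogonalProjectionOnto.toLinearMap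
  have hi : Function.Injective i := fun x y hxy =>
    Subtype.ext (Subtype.ext (congrArg (fun w : D => (w : H)) hxy))
  have hP : Function.Surjective P := fun y =>
    ⟨y, Kᗮ.orthogonalProjectionOnto_mem_subspace_eq_self y⟩
  have hPker : (LinearMap.ker P).FG := by
    have : LinearMap.ker P = K := by
      ext x
      change Kᗮ.orthogonalProjectionOnto x = 0 ↔ _
      rw [Submodule.orthogonalProjectionOnto_eq_zero_iff, Submodule.orthogonal_orthogonal]
    rw [this]
    exact Module.Finite.iff_fg.mp inferInstance
  have hicoker : (LinearMap.range i).CoFG := by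
    refine Submodule.cofg_iff_exists_fg_sup_eq_top.mpr ⟨K.comap D.subtype, ?_, ?_⟩
    · refine Submodule.fg_of_fg_map_injective D.subtype D.subtype_injective ?_
      have hKfg : K.FG := Module.Finite.iff_fg.mp inferInstance
      exact hKfg.of_le (Submodule.map_comap_le _ _)
    -- Since `K` lies in `D(T)`, subtracting from `x` its projection onto `K` stays in the domain
    -- and lands in `Kᗮ`.
    · refine eq_top_iff.mpr fun x _ => ?_
      have hk : ((K.orthogonalProjectionOnto (x : H) : K) : H) ∈ T.domain := hK (SetLike.coe_mem _)
      let k : D := ⟨K.orthogonalProjectionOnto (x : H), hk, hdom hk⟩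
      have hperp : ((x - k : D) : H) ∈ Kᗮ := K.sub_starProjection_mem_orthogonal (x : H)
      rw [← sub_add_cancel x k]
      refine Submodule.add_mem_sup ⟨⟨⟨_, hperp⟩, (x - k).2.1, ?_⟩, rfl⟩
        (SetLike.coe_mem (K.orthogonalProjectionOnto (x : H)))
      exact ⟨(x - k).2.1, (x - k).2.2⟩
  have hcomp : (subScalar (part T Kᗮ hK₂ + compression (A.domRestrict T.domain) Kᗮ) z).toFun =
      P ∘ₗ (subScalar (T + A) z).toFun ∘ₗ i := by
    refine LinearMap.ext fun x => ?_
    let y : T.domain := ⟨((x : Kᗮ) : H), x.2.1⟩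
    have hTy : P (T y) = ⟨T y, hK₂ y (x : Kᗮ).2⟩ :=
      Kᗮ.orthogonalProjectionOnto_mem_subspace_eq_self ⟨T y, hK₂ y (x : Kᗮ).2⟩
    have hy : P y = (x : Kᗮ) := Kᗮ.orthogonalProjectionOnto_mem_subspace_eq_self (x : Kᗮ)
    change (⟨T y, hK₂ y (x : Kᗮ).2⟩ : Kᗮ) + P (A ⟨y, hdom y.2⟩) - z • (x : Kᗮ) =
      P (T y + A ⟨y, hdom y.2⟩ - z • (y : H))
    rw [map_sub, map_add, map_smul, hTy, hy]
  rw [hcomp, LinearMap.isAlgFredholm_comp_iff_of_surjective hP hPker,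
    LinearMap.isAlgFredholm_comp_iff_of_injective hi hicoker]

end UnboundedOp

/-! ### Analytic Fredholm theory. -/

section AnalyticFredholm

open Filter Topology
open scoped ContDiff

theorem ContDiffAt.linearMap_det {N E : Type*} [NormedAddCommGroup N] [NormedSpace ℂ N]
    [FiniteDimensional ℂ N] [NormedAddCommGroup E] [NormedSpace ℂ E] {n : WithTop ℕ∞}
    {f : E → N →L[ℂ] N} {x : E} (hf : ContDiffAt ℂ n f x) :
    ContDiffAt ℂ n (fun w => LinearMap.det (f w : N →ₗ[ℂ] N)) x := by
  classical
  let b := Module.finBasis ℂ N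
  have h : (fun w => LinearMap.det (f w : N →ₗ[ℂ] N)) = fun w =>
      ∑ σ : Equiv.Perm (Fin (Module.finrank ℂ N)), ((Equiv.Perm.sign σ : ℤ) : ℂ) *
        ∏ i, (b.coord (σ i)).toContinuousLinearMap (f w (b i)) := by
    funext w
    rw [← LinearMap.det_toMatrix b, Matrix.det_apply']
    simp [LinearMap.toMatrix_apply]
  rw [h]
  refine ContDiffAt.sum fun σ _ => contDiffAt_const.mul (contDiffAt_prod fun i _ => ?_)
  exact (ContinuousLinearMap.contDiff _).contDiffAt.comp x (hf.clm_apply contDiffAt_const)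

/-- Schur complement criterion: if `(x, c) ↦ (L x + c, π x)` is invertible, then `L` is bijective
iff the lower right corner of the inverse is. -/
theorem bijective_iff_bijective_schur {X Y N : Type*} [AddCommGroup X] [Module ℂ X]
    [AddCommGroup Y] [Module ℂ Y] [AddCommGroup N] [Module ℂ N] (C : Submodule ℂ Y)
    (L : X →ₗ[ℂ] Y) (π : X →ₗ[ℂ] N) (e : (X × C) ≃ₗ[ℂ] (Y × N))
    (he : ∀ x c, e (x, c) = (L x + c, π x)) :
    Function.Bijective L ↔ Function.Bijective fun n : N => (e.symm (0, n)).2 := by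
  have hsymm : ∀ y n, L (e.symm (y, n)).1 + (e.symm (y, n)).2 = y ∧ π (e.symm (y, n)).1 = n := by
    intro y n
    have h := he (e.symm (y, n)).1 (e.symm (y, n)).2
    rw [Prod.mk.eta, e.apply_symm_apply] at h
    exact ⟨(congrArg Prod.fst h).symm, (congrArg Prod.snd h).symm⟩
  let E : N →ₗ[ℂ] C := LinearMap.snd ℂ X C ∘ₗ e.symm.toLinearMap ∘ₗ LinearMap.inr ℂ Y N
  change _ ↔ Function.Bijective E
  have hE : ∀ n, E n = (e.symm (0, n)).2 := fun _ => rfl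
  constructor
  · rintro ⟨hinj, hsurj⟩
    refine ⟨(injective_iff_map_eq_zero E).mpr fun n hn => ?_, fun c => ?_⟩
    · obtain ⟨h1, h2⟩ := hsymm 0 n
      rw [← hE, hn, Submodule.coe_zero, add_zero] at h1
      rw [(injective_iff_map_eq_zero L).mp hinj _ h1, map_zero] at h2
      exact h2.symm
    · obtain ⟨x, hx⟩ := hsurj (-c)
      have h : e (x, c) = (0, π x) := by rw [he, hx, neg_add_cancel]
      exact ⟨π x, by rw [hE, ← h, e.symm_apply_apply]⟩
  · rintro ⟨hinj, hsurj⟩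
    refine ⟨(injective_iff_map_eq_zero L).mpr fun x hx => ?_, fun y => ?_⟩
    · have h : e (x, 0) = (0, π x) := by rw [he, hx, Submodule.coe_zero, add_zero]
      have h0 : π x = 0 := (injective_iff_map_eq_zero E).mp hinj _ (by
        rw [hE, ← h, e.symm_apply_apply])
      rw [h0] at h
      exact congrArg Prod.fst (e.map_eq_zero_iff.mp h)
    · obtain ⟨n, hn⟩ := hsurj (e.symm (y, 0)).2
      refine ⟨(e.symm (y, 0)).1 - (e.symm (0, n)).1, ?_⟩
      have h1 := (hsymm y 0).1
      have h2 := (hsymm 0 n).1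
      rw [← hE, hn] at h2
      rw [map_sub, eq_neg_of_add_eq_zero_left h2, sub_neg_eq_add, h1]

theorem ContDiffAt.sub_smul_clm {X Y : Type*} [NormedAddCommGroup X] [NormedSpace ℂ X]
    [NormedAddCommGroup Y] [NormedSpace ℂ Y] {n : WithTop ℕ∞} (B C : X →L[ℂ] Y) (z : ℂ) :
    ContDiffAt ℂ n (fun w : ℂ => B - w • C) z :=
  contDiffAt_const.sub (contDiffAt_id.smul contDiffAt_const)

/-- Local analytic Fredholm alternative: if `L z₀` has finite-dimensional kernel and cokernel and
`L w` is bijective for `w` arbitrarily close to `z₀`, then `L w` is bijective in a punctured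
neighbourhood of `z₀`, and `L z₀` is surjective if it is injective. -/
theorem ContDiffAt.eventually_bijective_of_frequently {X Y : Type*} [NormedAddCommGroup X]
    [NormedSpace ℂ X] [CompleteSpace X] [NormedAddCommGroup Y] [NormedSpace ℂ Y] [CompleteSpace Y]
    {L : ℂ → X →L[ℂ] Y} {z₀ : ℂ} (hL : ContDiffAt ℂ ω L z₀)
    (hker : FiniteDimensional ℂ (LinearMap.ker (L z₀).toLinearMap))
    (hcoker : (LinearMap.range (L z₀).toLinearMap).CoFG)
    (hfreq : ∃ᶠ w in 𝓝 z₀, Function.Bijective (L w)) :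
    (∀ᶠ w in 𝓝[≠] z₀, Function.Bijective (L w)) ∧
      (Function.Injective (L z₀) → Function.Surjective (L z₀)) := by
  let N := LinearMap.ker (L z₀).toLinearMap
  obtain ⟨C, hC⟩ := (LinearMap.range (L z₀).toLinearMap).exists_isCompl
  have hCfin : FiniteDimensional ℂ C := Module.Finite.iff_fg.mpr (hcoker.fg_of_isCompl hC)
  obtain ⟨π, hπ⟩ := Submodule.ClosedComplemented.of_finiteDimensional N
  -- The bordered operator: `C` supplies the missing range and `π` detects the kernel, so `G z₀` is
  -- invertible, and hence so is `G w` nearby.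
  let G : ℂ → (X × C) →L[ℂ] (Y × N) := fun w =>
    (ContinuousLinearMap.inl ℂ Y N).comp ((L w).comp (ContinuousLinearMap.fst ℂ X C)) +
      (C.subtypeL.comp (ContinuousLinearMap.snd ℂ X C)).prod
        (π.comp (ContinuousLinearMap.fst ℂ X C))
  have hG : ∀ w x c, G w (x, c) = (L w x + c, π x) := fun w x c => by simp [G]
  have hGan : ContDiffAt ℂ ω G z₀ :=
    (contDiffAt_const.clm_comp (hL.clm_comp contDiffAt_const)).add contDiffAt_const
  have hCN : CompleteSpace C := FiniteDimensional.complete ℂ C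
  have hNN : CompleteSpace N := FiniteDimensional.complete ℂ N
  have hGinj : LinearMap.ker (G z₀).toLinearMap = ⊥ := by
    rw [LinearMap.ker_eq_bot']
    rintro ⟨x, c⟩ h
    have h' : (L z₀ x + c, π x) = (0 : Y × N) := (hG z₀ x c).symm.trans h
    have h1 : L z₀ x + c = 0 := congrArg Prod.fst h'
    have h2 : π x = 0 := congrArg Prod.snd h'
    have hc : (c : Y) = 0 := by
      refine Submodule.disjoint_def.mp hC.disjoint c ⟨-x, ?_⟩ c.2
      change L z₀ (-x) = c
      rw [map_neg, neg_eq_of_add_eq_zero_right h1]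
    rw [hc, add_zero] at h1
    have hx : x = 0 := by
      have := hπ ⟨x, h1⟩
      rw [h2] at this
      exact congrArg Subtype.val this.symm
    exact Prod.ext hx (Subtype.ext hc)
  have hGsurj : LinearMap.range (G z₀).toLinearMap = ⊤ := by
    rw [LinearMap.range_eq_top]
    rintro ⟨y, n⟩
    have hy : y ∈ LinearMap.range (L z₀).toLinearMap ⊔ C := hC.sup_eq_top ▸ Submodule.mem_top
    obtain ⟨_, ⟨x, rfl⟩, c, hc, rfl⟩ := Submodule.mem_sup.mp hy
    -- Correcting `x` by kernel elements leaves `L z₀ x` unchanged and makes its image under `π`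
    -- equal to `n`.
    refine ⟨(x - π x + n, ⟨c, hc⟩), (hG _ _ _).trans ?_⟩
    have h1 : L z₀ (π x : X) = 0 := (π x).2
    have h2 : L z₀ (n : X) = 0 := n.2
    simp [map_add, map_sub, h1, h2, hπ]
  let e := ContinuousLinearEquiv.ofBijective (G z₀) hGinj hGsurj
  have he : (e : (X × C) →L[ℂ] (Y × N)) = G z₀ := ContinuousLinearEquiv.coe_ofBijective _ _ _
  have hinv : ∀ᶠ w in 𝓝 z₀, ∃ e' : (X × C) ≃L[ℂ] (Y × N), (e' : (X × C) →L[ℂ] (Y × N)) = G w :=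
    hGan.continuousAt.eventually (he ▸ ContinuousLinearEquiv.nhds e)
  have hinvan : ContDiffAt ℂ ω (fun w => (G w).inverse) z₀ :=
    ContDiffAt.comp (g := ContinuousLinearMap.inverse) z₀ (he ▸ contDiffAt_map_inverse e) hGan
  let E : ℂ → N →L[ℂ] C := fun w =>
    (ContinuousLinearMap.snd ℂ X C).comp ((G w).inverse.comp (ContinuousLinearMap.inr ℂ Y N))
  have hEan : ContDiffAt ℂ ω E z₀ :=
    contDiffAt_const.clm_comp (hinvan.clm_comp contDiffAt_const)
  have hLE : ∀ᶠ w in 𝓝 z₀, (Function.Bijective (L w) ↔ Function.Bijective (E w)) := by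
    filter_upwards [hinv] with w ⟨e', he'⟩
    have hEw : ⇑(E w) = fun n : N => (e'.toLinearEquiv.symm (0, n)).2 := by
      funext n
      simp only [E, ← he', ContinuousLinearMap.inverse_equiv]
      rfl
    rw [hEw]
    refine bijective_iff_bijective_schur C (L w).toLinearMap π.toLinearMap e'.toLinearEquiv ?_
    intro x c
    refine Eq.trans ?_ (hG w x c)
    rw [← he']
    rfl
  -- A single nearby point of bijectivity forces `N` and `C` to have equal dimension, that is, index
  -- zero; the resulting `J` turns `E w` into an endomorphism with a determinant.
  obtain ⟨w₁, hw₁, hw₁'⟩ := (hfreq.and_eventually hLE).exists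
  let J : N ≃ₗ[ℂ] C := LinearEquiv.ofBijective (E w₁).toLinearMap (hw₁'.mp hw₁)
  have hdim : Module.finrank ℂ N = Module.finrank ℂ C := J.finrank_eq
  let M : ℂ → N →L[ℂ] N := fun w => J.symm.toContinuousLinearEquiv.toContinuousLinearMap.comp (E w)
  have hMan : ContDiffAt ℂ ω M z₀ := contDiffAt_const.clm_comp hEan
  have hdet : ∀ w, LinearMap.det (M w : N →ₗ[ℂ] N) ≠ 0 ↔ Function.Bijective (E w) := by
    intro w
    have h1 : Function.Bijective (M w) ↔ Function.Bijective (E w) :=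
      J.symm.bijective.of_comp_iff' _
    rw [← h1, ← isUnit_iff_ne_zero, ← LinearMap.isUnit_iff_isUnit_det,
      Module.End.isUnit_iff]
    rfl
  constructor
  · rcases (hMan.linearMap_det.analyticAt).eventually_eq_zero_or_eventually_ne_zero with h | h
    · obtain ⟨w, hw, hw', hw''⟩ := (hfreq.and_eventually (hLE.and h)).exists
      exact absurd hw'' ((hdet w).mpr (hw'.mp hw))
    · filter_upwards [h, hLE.filter_mono nhdsWithin_le_nhds] with w hw hw'
      exact hw'.mpr ((hdet w).mp hw)
  · intro hinj
    have hN : N = ⊥ := LinearMap.ker_eq_bot.mpr hinj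
    have hC0 : C = ⊥ := by
      rw [← Submodule.finrank_eq_zero (R := ℂ), ← hdim, hN, finrank_bot]
    have := hC.sup_eq_top
    rw [hC0, sup_bot_eq] at this
    exact LinearMap.range_eq_top.mp this

/-! ### Spectrum of a closed operator off its essential spectrum. -/

namespace UnboundedOp

variable {H : Type*} [NormedAddCommGroup H] [InnerProductSpace ℂ H]

/-- `S - z` as a bounded operator on the graph of `S`. -/
noncomputable def graphSubScalar (S : H →ₗ.[ℂ] H) (z : ℂ) : S.graph →L[ℂ] H :=
  (ContinuousLinearMap.snd ℂ H H).comp S.graph.subtypeL -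
    z • (ContinuousLinearMap.fst ℂ H H).comp S.graph.subtypeL

/-- The domain of `S` is linearly equivalent to its graph. -/
noncomputable def domainEquivGraph (S : H →ₗ.[ℂ] H) : S.domain ≃ₗ[ℂ] S.graph :=
  LinearEquiv.ofBijective
    (LinearMap.codRestrict S.graph (S.domain.subtype.prod S.toFun) fun x => S.mem_graph x)
    ⟨fun x y h => Subtype.ext (congrArg (fun p : S.graph => p.1.1) h), by
      rintro ⟨p, hp⟩
      obtain ⟨x, hx, hy⟩ := (LinearPMap.mem_graph_iff _).mp hp
      exact ⟨x, Subtype.ext (Prod.ext hx hy)⟩⟩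

theorem graphSubScalar_comp (S : H →ₗ.[ℂ] H) (z : ℂ) :
    (graphSubScalar S z).toLinearMap ∘ₗ (domainEquivGraph S).toLinearMap =
      (subScalar S z).toFun := rfl

theorem bijective_graphSubScalar_iff (S : H →ₗ.[ℂ] H) (z : ℂ) :
    Function.Bijective (graphSubScalar S z) ↔ z ∈ resolventSet S := by
  change _ ↔ Function.Bijective (subScalar S z).toFun
  rw [← graphSubScalar_comp]
  exact ((domainEquivGraph S).bijective.of_comp_iff _).symm

/-- Closedness makes the graph complete, so the bounded local alternative applies to
`graphSubScalar`; `domainEquivGraph` transfers the result back. -/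
theorem eventually_mem_resolventSet [CompleteSpace H] {S : H →ₗ.[ℂ] H} (hS : S.IsClosed) {z : ℂ}
    (hz : z ∉ essSpectrum S) (hfreq : ∃ᶠ w in 𝓝 z, w ∈ resolventSet S) :
    (∀ᶠ w in 𝓝[≠] z, w ∈ resolventSet S) ∧
      (Function.Injective (subScalar S z).toFun → Function.Surjective (subScalar S z).toFun) := by
  obtain ⟨-, hker, hcoker⟩ := not_not.mp hz
  have hcomplete : CompleteSpace S.graph := hS.completeSpace_coe
  have hcd : ContDiffAt ℂ ω (graphSubScalar S) z :=
    ContDiffAt.sub_smul_clm _ _ z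
  have hker' : FiniteDimensional ℂ (LinearMap.ker (graphSubScalar S z).toLinearMap) := by
    refine Module.Finite.iff_fg.mpr ?_
    have h : LinearMap.ker (graphSubScalar S z).toLinearMap =
        (LinearMap.ker (subScalar S z).toFun).map (domainEquivGraph S).toLinearMap := by
      change _ = (LinearMap.ker ((graphSubScalar S z).toLinearMap ∘ₗ
        (domainEquivGraph S).toLinearMap)).map _
      rw [LinearMap.ker_comp]
      exact (Submodule.map_comap_eq_of_surjective (domainEquivGraph S).surjective _).symm
    rw [h]
    exact (Module.Finite.iff_fg.mp hker).map _
  have hrange : LinearMap.range (subScalar S z).toFun =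
      LinearMap.range (graphSubScalar S z).toLinearMap := by
    rw [← graphSubScalar_comp]
    exact LinearMap.range_comp_of_range_eq_top _ (domainEquivGraph S).range
  have hcoker' : (LinearMap.range (graphSubScalar S z).toLinearMap).CoFG := hrange ▸ hcoker
  obtain ⟨h1, h2⟩ := hcd.eventually_bijective_of_frequently hker' hcoker'
    (hfreq.mono fun w hw => (bijective_graphSubScalar_iff S w).mpr hw)
  refine ⟨h1.mono fun w hw => (bijective_graphSubScalar_iff S w).mp hw, fun hinj => ?_⟩
  rw [← graphSubScalar_comp] at hinj ⊢
  refine (h2 ?_).comp (domainEquivGraph S).surjective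
  exact (Function.Injective.of_comp_iff' _ (domainEquivGraph S).bijective).mp hinj

/-- On a connected open set that avoids the essential spectrum and meets the resolvent set, every
point has a punctured neighbourhood in the resolvent set. -/
theorem eventually_mem_resolventSet_of_isConnected [CompleteSpace H] {S : H →ₗ.[ℂ] H}
    (hS : S.IsClosed) {U : Set ℂ} (hUc : IsPreconnected U) (hUess : U ⊆ (essSpectrum S)ᶜ)
    (hUρ : (U ∩ resolventSet S).Nonempty) {z : ℂ} (hz : z ∈ U) :
    ∀ᶠ w in 𝓝[≠] z, w ∈ resolventSet S := by
  -- `W` is open, meets `U`, and is relatively closed in `U`: a point of `U` in its closure is a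
  -- limit of resolvent points, so the local alternative applies there.
  let W : Set ℂ := {z | ∀ᶠ w in 𝓝[≠] z, w ∈ resolventSet S}
  have hW : IsOpen W := by
    refine isOpen_iff_mem_nhds.mpr fun z hz => ?_
    have h1 : ∀ᶠ w in 𝓝[≠] z, w ∈ W := by
      filter_upwards [eventually_eventually_nhdsWithin.mpr hz, self_mem_nhdsWithin] with w hw hwz
      rw [isOpen_compl_singleton.nhdsWithin_eq hwz] at hw
      exact hw.filter_mono nhdsWithin_le_nhds
    filter_upwards [eventually_nhdsWithin_iff.mp h1] with w hw
    by_cases hwz : w = z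
    · exact hwz ▸ hz
    · exact hw hwz
  refine hUc.subset_of_closure_inter_subset hW ?_ ?_ hz
  · obtain ⟨z₁, hz₁, hz₁'⟩ := hUρ
    exact ⟨z₁, hz₁, (eventually_mem_resolventSet hS (hUess hz₁)
      (frequently_iff.mpr fun hV => ⟨z₁, mem_of_mem_nhds hV, hz₁'⟩)).1⟩
  · rintro z ⟨hzW, hzU⟩
    refine (eventually_mem_resolventSet hS (hUess hzU) ?_).1
    refine frequently_iff.mpr fun {V} hV => ?_
    obtain ⟨V', hV', hVo, hzV⟩ := mem_nhds_iff.mp hV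
    obtain ⟨w, hwV, hw⟩ := mem_closure_iff.mp hzW V' hVo hzV
    obtain ⟨u, hu, hu'⟩ := (Eventually.and (f := 𝓝[≠] w) hw
      (mem_nhdsWithin_of_mem_nhds (hVo.mem_nhds hwV))).exists
    exact ⟨u, hV' hu', hu⟩

theorem spectrum_inter_of_isConnected [CompleteSpace H] {S : H →ₗ.[ℂ] H}
    (hS : S.IsClosed) {U : Set ℂ} (hUo : IsOpen U) (hUc : IsPreconnected U)
    (hUess : U ⊆ (essSpectrum S)ᶜ) (hUρ : (U ∩ resolventSet S).Nonempty) :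
    UnboundedOp.spectrum S ∩ U ⊆ eigenvalues S ∧ (UnboundedOp.spectrum S ∩ U).Countable ∧
      ∀ z : ℂ, AccPt z (𝓟 (UnboundedOp.spectrum S ∩ U)) → z ∈ frontier U := by
  have key : ∀ z ∈ U, ∀ᶠ w in 𝓝[≠] z, w ∈ resolventSet S := fun z hz =>
    eventually_mem_resolventSet_of_isConnected hS hUc hUess hUρ hz
  have hacc : ∀ z ∈ U, ¬ AccPt z (𝓟 (UnboundedOp.spectrum S ∩ U)) := by
    intro z hz h
    rw [accPt_iff_frequently_nhdsNE] at h
    obtain ⟨w, hw, hw'⟩ := (h.and_eventually (key z hz)).exists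
    exact hw.1 hw'
  refine ⟨?_, ?_, fun z hz => ?_⟩
  · rintro z ⟨hzσ, hzU⟩
    have h := (eventually_mem_resolventSet hS (hUess hzU)
      ((key z hzU).frequently.filter_mono nhdsWithin_le_nhds)).2
    have hinj : ¬ Function.Injective (subScalar S z).toFun := fun hi => hzσ ⟨hi, h hi⟩
    rw [injective_iff_map_eq_zero] at hinj
    push Not at hinj
    obtain ⟨x, hx, hx0⟩ := hinj
    exact ⟨x, hx0, sub_eq_zero.mp hx⟩
  -- Without accumulation points in itself the set is discrete, and a discrete subset of the plane
  -- is countable.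
  · have : DiscreteTopology ↥(UnboundedOp.spectrum S ∩ U) :=
      discreteTopology_of_noAccPts fun z hz => hacc z hz.2
    exact Set.countable_coe_iff.mp countable_of_Lindelof_of_discrete
  · rw [hUo.frontier_eq]
    refine ⟨?_, fun hzU => hacc z hzU hz⟩
    exact closure_mono Set.inter_subset_right (mem_closure_iff_clusterPt.mpr hz.clusterPt)

end UnboundedOp

end AnalyticFredholm

open UnboundedOp in
theorem mainTheorem5 {H : Type*} [NormedAddCommGroup H] [InnerProductSpace ℂ H] [CompleteSpace H]
    (T A : H →ₗ.[ℂ] H) (a b : ℝ)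
    (hT : IsNormal T) (hA : IsRelBoundedWith T A a b) (hδ : relBound T A < 1)
    (K : Submodule ℂ H) [FiniteDimensional ℂ K] (hK : K ≤ T.domain)
    (hK₁ : ∀ x : T.domain, (x : H) ∈ K → T x ∈ K)
    (hK₂ : ∀ x : T.domain, (x : H) ∈ Kᗮ → T x ∈ Kᗮ) :
    (T + A).IsClosed ∧
    (part T Kᗮ hK₂ + compression (A.domRestrict T.domain) Kᗮ).IsClosed ∧
    IsRelBoundedWith (part T Kᗮ hK₂) (compression (A.domRestrict T.domain) Kᗮ) a b ∧
    essSpectrum (T + A) =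
      essSpectrum (part T Kᗮ hK₂ + compression (A.domRestrict T.domain) Kᗮ) ∧
    ∀ U : Set ℂ, IsOpen U → IsConnected U → U ⊆ (essSpectrum (T + A))ᶜ →
      (U ∩ resolventSet (T + A)).Nonempty →
        UnboundedOp.spectrum (T + A) ∩ U ⊆ eigenvalues (T + A) ∧
        (UnboundedOp.spectrum (T + A) ∩ U).Countable ∧
        ∀ z : ℂ, AccPt z (Filter.principal (UnboundedOp.spectrum (T + A) ∩ U)) →
          z ∈ frontier U := by
  obtain ⟨a', b', hb', hA'⟩ := exists_isRelBoundedWith_lt_one hA hδ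
  have hclosed : (T + A).IsClosed := isClosed_add hT.isClosed hA' hb'
  have hclosed₂ : (part T Kᗮ hK₂ + compression (A.domRestrict T.domain) Kᗮ).IsClosed :=
    isClosed_add (isClosed_part hT.isClosed Kᗮ hK₂) (hA'.part_compression Kᗮ hK₂) hb'
  refine ⟨hclosed, hclosed₂, hA.part_compression Kᗮ hK₂, ?_, ?_⟩
  · ext z
    rw [mem_essSpectrum_iff hclosed, mem_essSpectrum_iff hclosed₂,
      isAlgFredholm_subScalar_iff hA.2.2.1 K hK hK₂ z]
  · intro U hUo hUc hUess hUρ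
    exact spectrum_inter_of_isConnected hclosed hUo hUc.isPreconnected hUess hUρ
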